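/- Let $\mathbb{N}^{<\mathbb{N}}$ be the set of finite words over $\mathbb{N}=\{0,1,2,\dots\}$ and give its power set $\mathcal P(\mathbb{N}^{<\mathbb{N}})$ the topology for which the sets $\{T : s\in T\}$, $s\in\mathbb{N}^{<\mathbb{N}}$, together with their complements, form a subbasis. A tree is a set $T\subseteq \mathbb{N}^{<\mathbb{N}}$ closed under initial segments; an infinite branch of $T$ is a $y\in\mathbb{N}^{\mathbb{N}}$ with $y|n=(y_0,\dots,y_{n-1})\in T$ for all $n\in\mathbb{N}$. Let $R$ be the set of pairs $(T,y)$ with $T$ a tree and $y$ an infinite branch of $T$, and let $IF$ be the set of ill-founded trees, i.e. trees that have an infinite branch. Let $(s_i)_{i\in\mathbb{N}}$ be any enumeration without repetition of $\mathbb{N}^{<\mathbb{N}}$. For $T\subseteq\mathbb{N}^{<\mathbb{N}}$ let $h(T)\in\{0,1\}^{\mathbb{N}}$ be given by $h(T)_i=1$ if $s_i\in T$ and $h(T)_i=0$ otherwise. Let $\sigma$ be the shift map $(\sigma z)_i=z_{i+1}$ on $\{0,1,2,3,4\}^{\mathbb{N}}$ (with the product topology). For $(T,y)\in R$ define, writing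 juxtaposition for concatenation, $$\omega_0(T,y)=3\,4\,0^\infty,\qquad \omega_n(T,y)=3\,(h(T)|n)\,2^{\,n+y_{n-1}}\,\omega_{n-1}(T,y)\quad(n\ge 1),$$ and let $$X=\{0,1,2,3\}^{\mathbb{N}}\cup\{\sigma^j(\omega_i(T,y)) : (T,y)\in R,\ i,j\in\mathbb{N}\}.$$ Then $X$ is a subshift (it is closed and $\sigma(X)\subseteq X$), and $\sigma(X)=X$. Moreover, let $\omega_0=3\,4\,0^\infty\in X$, and let $s\alpha(\omega_0)\subseteq X$ be its special $\alpha$-limit set under $\sigma|_X$, that is, the union of the sets of accumulation points of all sequences $(x_n)_{n\in\mathbb{N}}$ in $X$ with $x_0=\omega_0$ and $\sigma(x_{n+1})=x_n$ for all $n$. Then $s\alpha(\omega_0)$ is $\mathbf{\Sigma}^1_1$-complete, i.e. it is an analytic but not a Borel subset of $X$. Furthermore, the map $f:\mathcal P(\mathbb{N}^{<\mathbb{N}})\to X$, $f(T)=3\,h(T)$, is well defined and continuous, and $f^{-1}(s\alpha(\omega_0))=IF$. -/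

import Mathlib

open Set Filter Topology MeasureTheory

namespace SpecialAlpha

/-! ### Special alpha-limit sets and completeness -/

section General

variable {Y : Type*}

/-- `u` is a backward orbit of `x` under `f`: `u 0 = x` and `f (u (n + 1)) = u n` for all `n`. -/
def IsBackwardOrbit (f : Y → Y) (x : Y) (u : ℕ → Y) : Prop :=
  u 0 = x ∧ ∀ n, f (u (n + 1)) = u n

/-- The special alpha-limit set of `x`: the union, over all backward orbits of `x`, of their sets
of accumulation points (cluster points of the sequence). -/
def specialAlphaLimit [TopologicalSpace Y] (f : Y → Y) (x : Y) : Set Y :=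
  ⋃ u ∈ {u : ℕ → Y | IsBackwardOrbit f x u}, {z | MapClusterPt z atTop u}

/-- A subset of a Polish space is `Σ¹₁`-complete if it is analytic but not Borel. -/
def IsSigmaOneOneComplete [TopologicalSpace Y] (s : Set Y) : Prop :=
  AnalyticSet s ∧ ¬ MeasurableSet[borel Y] s

end General

/-! ### Words -/

/-- Concatenation of a finite word with an infinite word. -/
def conc {A : Type*} (l : List A) (z : ℕ → A) : ℕ → A :=
  fun i => if h : i < l.length then l[i] else z (i - l.length)

/-- The initial segment `z|n = (z 0, …, z (n - 1))` of an infinite word. -/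
def initSeg {A : Type*} (z : ℕ → A) (n : ℕ) : List A :=
  (List.range n).map z

/-! ### Trees and the space of sets of words -/

/-- The topology on the power set of the set of finite words over `ℕ` for which the sets
`{T | s ∈ T}` and their complements form a subbasis, i.e. the topology of the Cantor space
of characteristic functions. -/
abbrev powerTopology : TopologicalSpace (Set (List ℕ)) :=
  TopologicalSpace.generateFrom
    ({U | ∃ s : List ℕ, U = {T | s ∈ T}} ∪ {U | ∃ s : List ℕ, U = {T | s ∈ T}ᶜ})

/-- A tree on `ℕ`: a set of finite words closed under taking initial segments. -/
def IsTree (T : Set (List ℕ)) : Prop :=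
  T ∈ Descriptive.tree ℕ

theorem isTree_iff (T : Set (List ℕ)) : IsTree T ↔ ∀ t ∈ T, ∀ s, s <+: t → s ∈ T :=
  ⟨fun h _ ht _ hs => Descriptive.Tree.mem_of_prefix (T := ⟨T, h⟩) hs ht,
    fun h x a hx => h _ hx x ⟨[a], rfl⟩⟩

/-- `y` is an infinite branch of `T`. -/
def IsInfiniteBranch (T : Set (List ℕ)) (y : ℕ → ℕ) : Prop :=
  ∀ n, initSeg y n ∈ T

/-- The set of pairs of an (ill-founded) tree and an infinite branch of it. -/
def branchPairs : Set (Set (List ℕ) × (ℕ → ℕ)) :=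
  {p | IsTree p.1 ∧ IsInfiniteBranch p.1 p.2}

/-- The set of ill-founded trees. -/
def illFounded : Set (Set (List ℕ)) :=
  {T | IsTree T ∧ ∃ y, IsInfiniteBranch T y}

/-! ### The subshift -/

/-- The one-sided full shift space on the symbols `0, 1, 2, 3, 4`, with the product topology of
the discrete topologies. -/
abbrev FullShift : Type := ℕ → Fin 5

/-- The shift map `(σ z)_i = z_(i + 1)`. -/
def shift (z : FullShift) : FullShift :=
  SymbolicDynamics.FullShift.shift (1 : ℕ) z

theorem shift_apply (z : FullShift) (i : ℕ) : shift z i = z (i + 1) :=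
  congrArg z (Nat.add_comm 1 i)

/-- A one-sided subshift: a closed set mapped into itself by the shift. -/
def IsSubshift (X : Set FullShift) : Prop :=
  IsClosed X ∧ MapsTo shift X X

open Classical in
/-- The characteristic sequence `h(T)` of a set `T` of words, relative to the enumeration `e` of
all words, as a sequence of symbols `0` and `1` of the full shift. -/
noncomputable def charSeq (e : ℕ ≃ List ℕ) (T : Set (List ℕ)) : FullShift :=
  fun i => if e i ∈ T then 1 else 0

/-- The points `ω_n(T, y)`: `ω_0 = 3 4 0^∞` and
`ω_n = 3 (h(T)|n) 2^(n + y_(n-1)) ω_(n-1)` for `n ≥ 1`. -/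
noncomputable def omegaSeq (e : ℕ ≃ List ℕ) (T : Set (List ℕ)) (y : ℕ → ℕ) : ℕ → FullShift
  | 0 => conc [3, 4] (fun _ => 0)
  | n + 1 => conc [3] (conc (initSeg (charSeq e T) (n + 1))
      (conc (List.replicate (n + 1 + y n) 2) (omegaSeq e T y n)))

/-- The subshift `X`: all sequences in the symbols `0, 1, 2, 3`, and all the points
`σ^j (ω_i(T, y))` with `y` an infinite branch of the tree `T`. -/
def codingShift (e : ℕ ≃ List ℕ) : Set FullShift :=
  {z | ∀ k, z k ∈ ({0, 1, 2, 3} : Set (Fin 5))} ∪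
    {z | ∃ T y, (T, y) ∈ branchPairs ∧ ∃ i j : ℕ, z = shift^[j] (omegaSeq e T y i)}

theorem mapsTo_shift_codingShift (e : ℕ ≃ List ℕ) :
    MapsTo shift (codingShift e) (codingShift e) := by
  rintro z (hz | ⟨T, y, hTy, i, j, rfl⟩)
  · exact Or.inl fun k => hz (1 + k)
  · exact Or.inr ⟨T, y, hTy, i, j + 1, (Function.iterate_succ_apply' _ _ _).symm⟩

theorem omegaZero_mem (e : ℕ ≃ List ℕ) :
    (conc [3, 4] (fun _ => 0) : FullShift) ∈ codingShift e :=
  Or.inr ⟨univ, fun _ => 0, ⟨(isTree_iff _).2 fun _ _ _ _ => mem_univ _, fun _ => mem_univ _⟩, 0, 0, rfl⟩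

/-- The restriction `σ|_X : X → X` of the shift map. -/
def codingShiftMap (e : ℕ ≃ List ℕ) : codingShift e → codingShift e :=
  (mapsTo_shift_codingShift e).restrict

/-- The point `ω_0 = 3 4 0^∞` of `X`. -/
def omegaZero (e : ℕ ≃ List ℕ) : codingShift e :=
  ⟨conc [3, 4] (fun _ => 0), omegaZero_mem e⟩

end SpecialAlpha

/-! The symbol 4 anchors every sequence of X that contains it: only zeros follow it, and such a
sequence is a tail of some ω_n(T,y). This gives closedness. Each ω_n is a proper tail of ω_(n+1),
which gives surjectivity. A branch y of T yields a backward orbit of ω_0 through all ω_n(T,y), and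
these converge to 3h(T). Conversely, suppose a backward orbit of ω_0 accumulates at 3h(T). Its
points near 3h(T) are of the form ω_k(S,x), with S close to T and k large
(`exists_omegaSeq_of_agree`). The runs of 2s record x, and since ω_k is readable
(`eq_of_omegaSeq_eq`), all these x agree where they are recorded. They glue to a branch of T, so the
preimage is IF. The limit set is analytic as a projection of a Borel set. If it were Borel, so would
be IF, which a diagonal argument against a universal closed relation excludes
(`not_measurableSet_wordSet_mem_illFounded`). -/

namespace SpecialAlpha

/-! ### Finite and infinite words -/

section Words

variable {A : Type*}

theorem conc_of_lt (l : List A) (z : ℕ → A) {i : ℕ} (h : i < l.length) : conc l z i = l[i] := by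
  simp [conc, h]

theorem conc_of_le (l : List A) (z : ℕ → A) {i : ℕ} (h : l.length ≤ i) :
    conc l z i = z (i - l.length) := by
  simp [conc, not_lt.2 h]

theorem conc_add (l : List A) (z : ℕ → A) (i : ℕ) : conc l z (l.length + i) = z i := by
  simp [conc]

theorem conc_singleton_zero (a : A) (z : ℕ → A) : conc [a] z 0 = a := rfl

theorem conc_singleton_succ (a : A) (z : ℕ → A) (i : ℕ) : conc [a] z (i + 1) = z i := rfl

@[simp] theorem length_initSeg (z : ℕ → A) (n : ℕ) : (initSeg z n).length = n := by
  simp [initSeg]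

theorem initSeg_eq_iff {z w : ℕ → A} {n : ℕ} :
    initSeg z n = initSeg w n ↔ ∀ i < n, z i = w i := by
  simp [initSeg]

theorem initSeg_take (z : ℕ → A) {k n : ℕ} (h : k ≤ n) : (initSeg z n).take k = initSeg z k := by
  simp [initSeg, ← List.map_take, List.take_range, min_eq_left h]

end Words

theorem shift_iterate_apply (j : ℕ) (z : FullShift) (i : ℕ) : shift^[j] z i = z (i + j) := by
  induction j generalizing z with
  | zero => rfl
  | succ j ih => rw [Function.iterate_succ_apply, ih, shift_apply, add_assoc]

/-! ### Decoding the points ω_n -/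

section Omega

variable (e : ℕ ≃ List ℕ) (T : Set (List ℕ)) (y : ℕ → ℕ)

theorem charSeq_eq_zero_or_one (i : ℕ) : charSeq e T i = 0 ∨ charSeq e T i = 1 := by
  unfold charSeq
  split_ifs <;> simp

theorem charSeq_eq_iff {T' : Set (List ℕ)} {i : ℕ} :
    charSeq e T i = charSeq e T' i ↔ (e i ∈ T ↔ e i ∈ T') := by
  unfold charSeq
  split_ifs <;> simp_all

theorem omegaSeq_zero (n : ℕ) : omegaSeq e T y n 0 = 3 := by
  cases n <;> rfl

theorem omegaSeq_succ_of_lt {n i : ℕ} (h : i < n + 1) :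
    omegaSeq e T y (n + 1) (i + 1) = charSeq e T i := by
  rw [omegaSeq, conc_singleton_succ, conc_of_lt _ _ (by simpa using h)]
  simp [initSeg]

/-- The length of the part of `ω_(n+1)` in front of `ω_n`. -/
def blockLength (n : ℕ) : ℕ := 1 + (n + 1) + (n + 1 + y n)

theorem omegaSeq_succ_of_lt_blockLength {n i : ℕ} (h : n + 1 ≤ i) (h' : i + 1 < blockLength y n) :
    omegaSeq e T y (n + 1) (i + 1) = 2 := by
  unfold blockLength at h'
  rw [omegaSeq, conc_singleton_succ, conc_of_le _ _ (by simpa using h), length_initSeg,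
    conc_of_lt _ _ (by simp; omega), List.getElem_replicate]

theorem omegaSeq_succ_add (n i : ℕ) :
    omegaSeq e T y (n + 1) (blockLength y n + i) = omegaSeq e T y n i := by
  unfold blockLength
  rw [omegaSeq, show 1 + (n + 1) + (n + 1 + y n) + i = (n + 1) + (n + 1 + y n + i) + 1 by omega,
    conc_singleton_succ]
  have := conc_add (initSeg (charSeq e T) (n + 1))
    (conc (List.replicate (n + 1 + y n) 2) (omegaSeq e T y n)) (n + 1 + y n + i)
  rw [length_initSeg] at this
  rw [this]
  simpa using conc_add (List.replicate (n + 1 + y n) 2) (omegaSeq e T y n) i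

theorem shift_iterate_omegaSeq_succ (n : ℕ) :
    shift^[blockLength y n] (omegaSeq e T y (n + 1)) = omegaSeq e T y n := by
  ext i
  rw [shift_iterate_apply, add_comm i, omegaSeq_succ_add]

/-- The length of the part of `ω_n` in front of `ω_0`. -/
def prefixLength (n : ℕ) : ℕ := ∑ i ∈ Finset.range n, blockLength y i

theorem prefixLength_succ (n : ℕ) :
    prefixLength y (n + 1) = prefixLength y n + blockLength y n :=
  Finset.sum_range_succ _ _

theorem blockLength_pos (n : ℕ) : 0 < blockLength y n := by
  unfold blockLength; omega

theorem strictMono_prefixLength : StrictMono (prefixLength y) :=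
  strictMono_nat_of_lt_succ fun n => by
    rw [prefixLength_succ]; exact Nat.lt_add_of_pos_right (blockLength_pos y n)

theorem shift_iterate_omegaSeq {n m : ℕ} (h : n ≤ m) :
    shift^[prefixLength y m - prefixLength y n] (omegaSeq e T y m) = omegaSeq e T y n := by
  induction m, h using Nat.le_induction with
  | base => simp
  | succ m h ih =>
    have := (strictMono_prefixLength y).monotone h
    rw [prefixLength_succ, show prefixLength y m + blockLength y m - prefixLength y n =
      (prefixLength y m - prefixLength y n) + blockLength y m by omega,
      Function.iterate_add_apply, shift_iterate_omegaSeq_succ, ih]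

/-- After the symbol `4` in a point `ω_n` only zeros follow. -/
theorem omegaSeq_eq_zero_of_eq_four {n p q : ℕ} (hp : omegaSeq e T y n p = 4) (hq : p < q) :
    omegaSeq e T y n q = 0 := by
  induction n generalizing p q with
  | zero =>
    obtain rfl | ⟨p, rfl⟩ : p = 0 ∨ ∃ r, p = r + 1 :=
      (Nat.eq_zero_or_eq_succ_pred p).imp id fun h => ⟨_, h⟩
    · exact absurd hp (by rw [omegaSeq_zero]; decide)
    · rw [omegaSeq, conc_of_le _ _ (by simp; omega)]
  | succ n ih =>
    have hle : blockLength y n ≤ p := by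
      by_contra! hlt
      obtain rfl | ⟨p, rfl⟩ : p = 0 ∨ ∃ r, p = r + 1 :=
        (Nat.eq_zero_or_eq_succ_pred p).imp id fun h => ⟨_, h⟩
      · exact absurd hp (by rw [omegaSeq_zero]; decide)
      rcases lt_or_ge p (n + 1) with h | h
      · rw [omegaSeq_succ_of_lt e T y h] at hp
        rcases charSeq_eq_zero_or_one e T p with h | h <;> rw [h] at hp <;> exact absurd hp (by decide)
      · rw [omegaSeq_succ_of_lt_blockLength e T y h hlt] at hp
        exact absurd hp (by decide)
    obtain ⟨p, rfl⟩ := Nat.exists_eq_add_of_le hle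
    obtain ⟨q, rfl⟩ := Nat.exists_eq_add_of_le (hle.trans hq.le)
    rw [omegaSeq_succ_add] at hp ⊢
    exact ih hp (by omega)

/-- The symbol `3` occurs in `ω_n` only as the first symbol of some `ω_m`. -/
theorem exists_omegaSeq_of_eq_three {n j : ℕ} (h : omegaSeq e T y n j = 3) :
    ∃ m ≤ n, shift^[j] (omegaSeq e T y n) = omegaSeq e T y m := by
  induction n generalizing j with
  | zero =>
    match j with
    | 0 => exact ⟨0, le_rfl, rfl⟩
    | 1 => exact absurd h (by show ¬ (4 : Fin 5) = 3; decide)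
    | j + 2 =>
      rw [omegaSeq, conc_of_le _ _ (by simp)] at h
      exact absurd h (by decide)
  | succ n ih =>
    rcases Nat.eq_zero_or_eq_succ_pred j with rfl | hj
    · exact ⟨n + 1, le_rfl, rfl⟩
    have hle : blockLength y n ≤ j := by
      by_contra! hlt
      rw [hj] at h hlt
      rcases lt_or_ge j.pred (n + 1) with h' | h'
      · rw [omegaSeq_succ_of_lt e T y h'] at h
        rcases charSeq_eq_zero_or_one e T j.pred with h' | h' <;> rw [h'] at h <;>
          exact absurd h (by decide)
      · rw [omegaSeq_succ_of_lt_blockLength e T y h' hlt] at h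
        exact absurd h (by decide)
    obtain ⟨j, rfl⟩ := Nat.exists_eq_add_of_le hle
    rw [omegaSeq_succ_add] at h
    obtain ⟨m, hm, hm'⟩ := ih h
    refine ⟨m, hm.trans n.le_succ, ?_⟩
    rw [add_comm, Function.iterate_add_apply, shift_iterate_omegaSeq_succ, hm']

variable {e T y}

/-- At position a + 2 the left side already shows a 2, whereas for a < b the right side is still
listing values of h. -/
theorem le_of_omegaSeq_succ_eq_succ {T' : Set (List ℕ)} {y' : ℕ → ℕ} {a b : ℕ}
    (h : omegaSeq e T y (a + 1) = omegaSeq e T' y' (b + 1)) : b ≤ a := by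
  by_contra! hlt
  have h1 := omegaSeq_succ_of_lt_blockLength e T y (le_refl (a + 1))
    (by unfold blockLength; omega)
  rw [h, omegaSeq_succ_of_lt e T' y' (by omega)] at h1
  rcases charSeq_eq_zero_or_one e T' (a + 1) with h' | h' <;> rw [h'] at h1 <;>
    exact absurd h1 (by decide)

/-- The 3 that opens ω_a would fall inside the run of 2s of a longer block. -/
theorem blockLength_le_of_omegaSeq_eq {T' : Set (List ℕ)} {y' : ℕ → ℕ} {a : ℕ}
    (h : omegaSeq e T y (a + 1) = omegaSeq e T' y' (a + 1)) :
    blockLength y' a ≤ blockLength y a := by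
  by_contra! hlt
  have h1 := omegaSeq_succ_add e T y a 0
  have h2 : blockLength y a = (blockLength y a - 1) + 1 := by unfold blockLength; omega
  rw [omegaSeq_zero, h, add_zero, h2, omegaSeq_succ_of_lt_blockLength e T' y'
    (by unfold blockLength; omega) (by omega)] at h1
  exact absurd h1 (by decide)

/-- The points `ω_n` determine `n` and the first `n` symbols of the branch. -/
theorem eq_of_omegaSeq_eq {T' : Set (List ℕ)} {y' : ℕ → ℕ} {a b : ℕ}
    (h : omegaSeq e T y a = omegaSeq e T' y' b) : a = b ∧ ∀ k < a, y k = y' k := by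
  have key : ∀ (S : Set (List ℕ)) (x : ℕ → ℕ) (S' : Set (List ℕ)) (x' : ℕ → ℕ) (n : ℕ),
      omegaSeq e S x 0 ≠ omegaSeq e S' x' (n + 1) := by
    intro S x S' x' n h
    have h1 := congrFun h 1
    rw [omegaSeq_succ_of_lt e S' x' n.succ_pos] at h1
    rcases charSeq_eq_zero_or_one e S' 0 with h' | h' <;> rw [h'] at h1 <;>
      exact absurd h1 (by first | (show ¬ (4 : Fin 5) = 0; decide) | (show ¬ (4 : Fin 5) = 1; decide))
  induction a generalizing b with
  | zero =>
    cases b with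
    | zero => simp
    | succ b => exact absurd h (key _ _ _ _ _)
  | succ a ih =>
    cases b with
    | zero => exact absurd h.symm (key _ _ _ _ _)
    | succ b =>
      obtain rfl : a = b :=
        le_antisymm (le_of_omegaSeq_succ_eq_succ h.symm) (le_of_omegaSeq_succ_eq_succ h)
      have hb : blockLength y a = blockLength y' a :=
        le_antisymm (blockLength_le_of_omegaSeq_eq h.symm) (blockLength_le_of_omegaSeq_eq h)
      have h' : omegaSeq e T y a = omegaSeq e T' y' a := by
        rw [← shift_iterate_omegaSeq_succ e T y, ← shift_iterate_omegaSeq_succ e T' y', h, hb]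
      refine ⟨rfl, fun k hk => ?_⟩
      rcases Nat.lt_succ_iff_lt_or_eq.1 hk with hk | rfl
      · exact (ih h').2 k hk
      · unfold blockLength at hb; omega

end Omega

/-! ### Cylinder neighbourhoods -/

theorem mem_zero_one_two_three_iff (a : Fin 5) : a ∈ ({0, 1, 2, 3} : Set (Fin 5)) ↔ a ≠ 4 := by
  fin_cases a <;> simp

/-- The set of points agreeing with `z` on the first `n` coordinates is a neighbourhood of `z`. -/
theorem setOf_forall_lt_eq_mem_nhds (z : FullShift) (n : ℕ) :
    {w : FullShift | ∀ i < n, w i = z i} ∈ 𝓝 z := by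
  have : {w : FullShift | ∀ i < n, w i = z i} = ⋂ i ∈ Finset.range n, {w | w i = z i} := by
    ext; simp
  rw [this]
  refine (isOpen_biInter_finset fun i _ => ?_).mem_nhds (by simp)
  exact (isOpen_discrete ({z i} : Set (Fin 5))).preimage (continuous_apply (A := fun _ => Fin 5) i)

theorem exists_forall_lt_eq_subset {z : FullShift} {s : Set FullShift} (hs : s ∈ 𝓝 z) :
    ∃ n, {w : FullShift | ∀ i < n, w i = z i} ⊆ s := by
  rw [nhds_pi, Filter.mem_pi] at hs
  obtain ⟨I, hI, t, ht, hts⟩ := hs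
  obtain ⟨n, hn⟩ := hI.bddAbove
  refine ⟨n + 1, fun w hw => hts fun i hi => ?_⟩
  rw [hw i (Nat.lt_succ_of_le (hn hi))]
  exact mem_of_mem_nhds (ht i)

theorem mapClusterPt_iff_forall_exists_agree {X : Set FullShift} (u : ℕ → X) (z : X) :
    MapClusterPt z atTop u ↔
      ∀ n, ∃ m ≥ n, ∀ i < n, (u m : FullShift) i = (z : FullShift) i := by
  rw [mapClusterPt_iff_frequently]
  constructor
  · intro h n
    exact frequently_atTop.1
      (h _ (continuous_subtype_val.continuousAt (setOf_forall_lt_eq_mem_nhds z n))) n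
  · intro h s hs
    rw [nhds_subtype, Filter.mem_comap] at hs
    obtain ⟨t, ht, hts⟩ := hs
    obtain ⟨n, hn⟩ := exists_forall_lt_eq_subset ht
    refine frequently_atTop.2 fun a => ?_
    obtain ⟨m, hm, hmz⟩ := h (max a n)
    exact ⟨m, (le_max_left _ _).trans hm,
      hts (hn fun i hi => hmz i (hi.trans_le (le_max_right _ _)))⟩

/-! ### X is a subshift and σ is onto -/

section Subshift

variable (e : ℕ ≃ List ℕ)

theorem omegaSeq_mem {T : Set (List ℕ)} {y : ℕ → ℕ} (h : (T, y) ∈ branchPairs) (n j : ℕ) :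
    shift^[j] (omegaSeq e T y n) ∈ codingShift e :=
  Or.inr ⟨T, y, h, n, j, rfl⟩

variable {e}

theorem eq_zero_of_eq_four {z : FullShift} (hz : z ∈ codingShift e) {p q : ℕ} (hp : z p = 4)
    (hq : p < q) : z q = 0 := by
  rcases hz with hz | ⟨T, y, -, n, j, rfl⟩
  · exact absurd hp ((mem_zero_one_two_three_iff _).1 (hz p))
  · rw [shift_iterate_apply] at *
    exact omegaSeq_eq_zero_of_eq_four e T y hp (by omega)

theorem exists_omegaSeq_of_eq_four {z : FullShift} (hz : z ∈ codingShift e) {p : ℕ}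
    (hp : z p = 4) :
    ∃ T y, (T, y) ∈ branchPairs ∧ ∃ i j : ℕ, z = shift^[j] (omegaSeq e T y i) :=
  hz.resolve_left fun hz => (mem_zero_one_two_three_iff _).1 (hz p) hp

variable (e)

theorem isClosed_codingShift : IsClosed (codingShift e) := by
  refine isClosed_of_closure_subset fun z hz => ?_
  by_cases h : ∀ k, z k ≠ 4
  · exact Or.inl fun k => (mem_zero_one_two_three_iff _).2 (h k)
  push Not at h
  obtain ⟨p, hp⟩ := h
  have agree : ∀ n, ∃ w ∈ codingShift e, ∀ i < n, w i = z i := fun n => by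
    obtain ⟨w, hw, hwX⟩ := mem_closure_iff_nhds.1 hz _ (setOf_forall_lt_eq_mem_nhds z n)
    exact ⟨w, hwX, hw⟩
  have hzero : ∀ q, p < q → z q = 0 := fun q hq => by
    obtain ⟨w, hwX, hw⟩ := agree (q + 1)
    rw [← hw q q.lt_succ_self]
    exact eq_zero_of_eq_four hwX ((hw p (by omega)).trans hp) hq
  -- A point of X agreeing with z through the 4 equals z, because both continue with zeros.
  obtain ⟨w, hwX, hw⟩ := agree (p + 1)
  convert hwX
  funext q
  rcases lt_or_ge p q with hq | hq
  · rw [hzero q hq, eq_zero_of_eq_four hwX ((hw p p.lt_succ_self).trans hp) hq]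
  · exact (hw q (Nat.lt_succ_of_le hq)).symm

theorem image_shift_codingShift : shift '' codingShift e = codingShift e := by
  refine (mapsTo_shift_codingShift e).image_subset.antisymm ?_
  rintro z (hz | ⟨T, y, hTy, i, j, rfl⟩)
  · refine ⟨conc [0] z, Or.inl fun k => ?_, funext fun k => ?_⟩
    · cases k with
      | zero => simp [conc_singleton_zero]
      | succ k => exact hz k
    · rw [shift_apply, conc_singleton_succ]
  -- ω_i is preceded by a whole block in ω_(i+1); the witness starts one symbol earlier.
  · refine ⟨shift^[j + (blockLength y i - 1)] (omegaSeq e T y (i + 1)),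
      omegaSeq_mem e hTy _ _, ?_⟩
    have := blockLength_pos y i
    rw [← Function.iterate_succ_apply' shift,
      show (j + (blockLength y i - 1)).succ = j + blockLength y i by omega,
      Function.iterate_add_apply, shift_iterate_omegaSeq_succ]

end Subshift

/-! ### Accumulation at 3h(T) and branches of T -/

section Fiber

variable {e : ℕ ≃ List ℕ}

/-- The point `f(T) = 3 h(T)` of `X`. -/
noncomputable def treePoint (e : ℕ ≃ List ℕ) (T : Set (List ℕ)) : codingShift e :=
  ⟨conc [3] (charSeq e T), Or.inl fun k => by
    cases k with
    | zero => simp [conc_singleton_zero]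
    | succ k =>
      rw [conc_singleton_succ]
      rcases charSeq_eq_zero_or_one e T k with h | h <;> simp [h]⟩

theorem coe_codingShiftMap (z : codingShift e) : (codingShiftMap e z : FullShift) = shift z := rfl

theorem shift_iterate_backwardOrbit {x : codingShift e} {u : ℕ → codingShift e}
    (hu : IsBackwardOrbit (codingShiftMap e) x u) (m k : ℕ) :
    shift^[k] (u (m + k) : FullShift) = u m := by
  induction k with
  | zero => rfl
  | succ k ih =>
    rw [Function.iterate_succ_apply, ← coe_codingShiftMap, ← add_assoc, hu.2, ih]

theorem mem_specialAlphaLimit_iff {Y : Type*} [TopologicalSpace Y] {f : Y → Y} {x z : Y} :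
    z ∈ specialAlphaLimit f x ↔ ∃ u, IsBackwardOrbit f x u ∧ MapClusterPt z atTop u := by
  simp [specialAlphaLimit]

theorem treePoint_mem_specialAlphaLimit {T : Set (List ℕ)} (hT : T ∈ illFounded) :
    treePoint e T ∈ specialAlphaLimit (codingShiftMap e) (omegaZero e) := by
  obtain ⟨hT, y, hy⟩ := hT
  have hTy : (T, y) ∈ branchPairs := ⟨hT, hy⟩
  have hL := strictMono_prefixLength y
  -- The tail of ω_k that reaches ω_0 after exactly k shifts; the subtraction does not truncate
  -- since k ≤ `prefixLength y k`.
  let u : ℕ → codingShift e := fun k =>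
    ⟨shift^[prefixLength y k - k] (omegaSeq e T y k), omegaSeq_mem e hTy _ _⟩
  have hu : ∀ n, (u (prefixLength y n) : FullShift) = omegaSeq e T y n := fun n =>
    shift_iterate_omegaSeq e T y (hL.id_le n)
  refine mem_specialAlphaLimit_iff.2 ⟨u, ⟨rfl, fun k => Subtype.ext ?_⟩, ?_⟩
  · rw [coe_codingShiftMap]
    change shift (shift^[_] _) = shift^[_] _
    rw [← Function.iterate_succ_apply' shift]
    have h1 := hL.id_le k
    have h2 := hL.id_le (k + 1)
    have h3 := hL.monotone k.le_succ
    simp only [id] at h1 h2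
    rw [← shift_iterate_omegaSeq e T y k.le_succ, ← Function.iterate_add_apply]
    exact congrArg (fun j => shift^[j] (omegaSeq e T y (k + 1))) (by
      simp only [Nat.succ_eq_add_one] at *; omega)
  · rw [mapClusterPt_iff_forall_exists_agree]
    refine fun n => ⟨prefixLength y n, hL.id_le n, fun i hi => ?_⟩
    rw [hu]
    obtain ⟨n, rfl⟩ := Nat.exists_eq_add_one_of_ne_zero (by omega : n ≠ 0)
    cases i with
    | zero => exact omegaSeq_zero e T y _
    | succ i => exact omegaSeq_succ_of_lt e T y (by omega)

/-- The 4 of ω_0 sits at position m + 1 of `u m`, so `u m` is a tail of some ω_i(S,x), and its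
initial 3 makes it an ω_k(S,x). If k < n, the symbol at position k + 1 would be 2 or 4 instead of a
value of h(T). -/
theorem exists_omegaSeq_of_agree {u : ℕ → codingShift e}
    (hu : IsBackwardOrbit (codingShiftMap e) (omegaZero e) u) {T : Set (List ℕ)} {m n : ℕ}
    (h : ∀ i < n + 1, (u m : FullShift) i = conc [3] (charSeq e T) i) :
    ∃ (S : Set (List ℕ)) (x : ℕ → ℕ) (k : ℕ), (S, x) ∈ branchPairs ∧ n ≤ k ∧
      (u m : FullShift) = omegaSeq e S x k ∧ ∀ i < n, e i ∈ S ↔ e i ∈ T := by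
  have h4 : (u m : FullShift) (1 + m) = 4 := by
    rw [← shift_iterate_apply m (u m : FullShift) 1]
    have := shift_iterate_backwardOrbit hu 0 m
    rw [zero_add] at this
    rw [this, hu.1]
    rfl
  obtain ⟨S, x, hSx, i, j, hij⟩ := exists_omegaSeq_of_eq_four (u m).2 h4
  have h3 : omegaSeq e S x i j = 3 := by
    rw [← zero_add j, ← shift_iterate_apply j (omegaSeq e S x i), ← hij, h 0 n.succ_pos, conc_singleton_zero]
  obtain ⟨k, -, hk⟩ := exists_omegaSeq_of_eq_three e S x h3
  rw [hk] at hij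
  have hnk : n ≤ k := by
    by_contra! hlt
    have h1 := h (k + 1) (by omega)
    rw [conc_singleton_succ, hij] at h1
    cases k with
    | zero =>
      have h1 : (4 : Fin 5) = charSeq e T 0 := h1
      rcases charSeq_eq_zero_or_one e T 0 with h' | h' <;> rw [h'] at h1 <;>
        exact absurd h1 (by decide)
    | succ k =>
      rw [omegaSeq_succ_of_lt_blockLength e S x le_rfl (by unfold blockLength; omega)] at h1
      rcases charSeq_eq_zero_or_one e T (k + 1) with h' | h' <;> rw [h'] at h1 <;>
        exact absurd h1 (by decide)
  refine ⟨S, x, k, hSx, hnk, hij, fun i hi => ?_⟩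
  obtain ⟨k, rfl⟩ := Nat.exists_eq_add_one_of_ne_zero (by omega : k ≠ 0)
  rw [← charSeq_eq_iff e, ← omegaSeq_succ_of_lt e S x (by omega : i < k + 1), ← hij,
    h (i + 1) (by omega), conc_singleton_succ]

/-- The points `ω_n` on a backward orbit read off the same branch. -/
theorem branch_agree_of_backwardOrbit {u : ℕ → codingShift e}
    (hu : IsBackwardOrbit (codingShiftMap e) (omegaZero e) u) {S S' : Set (List ℕ)} {x x' : ℕ → ℕ}
    {m m' k k' : ℕ} (h : (u m : FullShift) = omegaSeq e S x k)
    (h' : (u m' : FullShift) = omegaSeq e S' x' k') {i : ℕ} (hi : i < k) (hi' : i < k') :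
    x i = x' i := by
  wlog hle : m ≤ m' generalizing m m' S S' x x' k k'
  · exact (this h' h hi' hi (le_of_not_ge hle)).symm
  obtain ⟨j, rfl⟩ := Nat.exists_eq_add_of_le hle
  have h1 := shift_iterate_backwardOrbit hu m j
  rw [h, h'] at h1
  have h3 : omegaSeq e S' x' k' j = 3 := by
    rw [← zero_add j, ← shift_iterate_apply j (omegaSeq e S' x' k'), h1, omegaSeq_zero]
  obtain ⟨l, -, hl⟩ := exists_omegaSeq_of_eq_three e S' x' h3
  exact (eq_of_omegaSeq_eq (h1.symm.trans hl)).2 i hi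

theorem mem_illFounded_of_treePoint_mem {T : Set (List ℕ)}
    (hT : treePoint e T ∈ specialAlphaLimit (codingShiftMap e) (omegaZero e)) :
    T ∈ illFounded := by
  obtain ⟨u, hu, hcl⟩ := mem_specialAlphaLimit_iff.1 hT
  rw [mapClusterPt_iff_forall_exists_agree] at hcl
  choose m _ hm using fun n => hcl (n + 1)
  choose S x k hSx hk hum hST using fun n => exists_omegaSeq_of_agree hu (hm n)
  have hindex : ∀ t : List ℕ, ∀ n > e.symm t, t ∈ S n ↔ t ∈ T := fun t n hn => by
    simpa using hST n (e.symm t) hn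
  -- Stage n records at least n symbols of `x n`, so symbol i is read at stage i + 1. Membership of
  -- a word in T is tested in `S N` for N beyond its index.
  refine ⟨(isTree_iff T).2 fun t ht s hst => ?_, fun i => x (i + 1) i, fun n => ?_⟩
  · let N := max (e.symm t) (e.symm s) + 1
    rw [← hindex s N (Nat.lt_succ_of_le (le_max_right _ _))]
    rw [← hindex t N (Nat.lt_succ_of_le (le_max_left _ _))] at ht
    exact (isTree_iff _).1 (hSx N).1 t ht s hst
  · set w := initSeg (fun i => x (i + 1) i) n with hw
    let N := max (e.symm w) n + 1
    have hwN : w = initSeg (x N) n := initSeg_eq_iff.2 fun i hi =>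
      branch_agree_of_backwardOrbit hu (hum (i + 1)) (hum N)
        ((Nat.lt_succ_self i).trans_le (hk _))
        (((hi.trans_le (le_max_right (e.symm w) n)).trans (Nat.lt_succ_self _)).trans_le (hk N))
    rw [← hindex w N (Nat.lt_succ_of_le (le_max_left _ _)), hwN]
    exact (hSx N).2 n

theorem preimage_treePoint :
    treePoint e ⁻¹' specialAlphaLimit (codingShiftMap e) (omegaZero e) = illFounded :=
  Subset.antisymm (fun _ => mem_illFounded_of_treePoint_mem)
    fun _ => treePoint_mem_specialAlphaLimit

theorem continuous_treePoint (e : ℕ ≃ List ℕ) :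
    Continuous[powerTopology, instTopologicalSpaceSubtype] (treePoint e) := by
  let _ : TopologicalSpace (Set (List ℕ)) := powerTopology
  refine Continuous.subtype_mk (continuous_pi fun i => ?_) _
  cases i with
  | zero => exact continuous_const
  | succ i =>
    have hopen : IsOpen {T : Set (List ℕ) | e i ∈ T} :=
      TopologicalSpace.isOpen_generateFrom_of_mem (Or.inl ⟨e i, rfl⟩)
    have hclosed : IsClosed {T : Set (List ℕ) | e i ∈ T} :=
      ⟨TopologicalSpace.isOpen_generateFrom_of_mem (Or.inr ⟨e i, rfl⟩)⟩
    classical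
    change Continuous fun T : Set (List ℕ) => if e i ∈ T then (1 : Fin 5) else 0
    exact continuous_const.if (fun T hT => by
      rw [IsClopen.frontier_eq ⟨hclosed, hopen⟩] at hT; exact hT.elim) continuous_const

end Fiber

/-! ### Analyticity, by projecting pairs (backward orbit, cluster point) -/

theorem analyticSet_specialAlphaLimit {Y : Type*} [TopologicalSpace Y] [PolishSpace Y] {f : Y → Y}
    (hf : Continuous f) (x : Y) : AnalyticSet (specialAlphaLimit f x) := by
  borelize Y
  obtain ⟨b, hbc, -, hb⟩ := TopologicalSpace.exists_countable_basis Y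
  have hset : specialAlphaLimit f x = Prod.snd '' ({p : (ℕ → Y) × Y | IsBackwardOrbit f x p.1} ∩
      {p | MapClusterPt p.2 atTop p.1}) := by
    ext z; simp [specialAlphaLimit]
  rw [hset]
  refine (MeasurableSet.inter ?_ ?_).analyticSet.image_of_continuous continuous_snd
  · refine IsClosed.measurableSet ?_
    simp only [IsBackwardOrbit, ofPred_and, ofPred_forall]
    exact (isClosed_eq (by fun_prop) continuous_const).inter
      (isClosed_iInter fun n => isClosed_eq (by fun_prop) (by fun_prop))
  · have : {p : (ℕ → Y) × Y | MapClusterPt p.2 atTop p.1} =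
        ⋂ s ∈ b, ⋂ n, ({p : (ℕ → Y) × Y | p.2 ∈ s}ᶜ ∪ ⋃ m ≥ n, {p | p.1 m ∈ s}) := by
      ext ⟨u, z⟩
      simp only [mem_ofPred_eq, mem_iInter, mem_union, mem_compl_iff, mem_iUnion, ge_iff_le,
        exists_prop]
      rw [hb.nhds_hasBasis.mapClusterPt_iff_frequently]
      simp only [frequently_atTop]
      exact ⟨fun h s hs n => or_iff_not_imp_left.2 fun hz => h s ⟨hs, not_not.1 hz⟩ n,
        fun h s hs n => (h s hs.1 n).resolve_left (not_not.2 hs.2)⟩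
    rw [this]
    refine MeasurableSet.biInter hbc fun s hs => MeasurableSet.iInter fun n => ?_
    have hs := (hb.isOpen hs).measurableSet
    exact (measurable_snd hs).compl.union (MeasurableSet.iUnion fun m => MeasurableSet.iUnion
      fun _ => ((measurable_pi_apply m).comp measurable_fst) hs)

theorem polishSpace_sequences (A : Type*) [TopologicalSpace A] [PolishSpace A] :
    PolishSpace (ℕ → A) :=
  inferInstance

/-! ### Ill-foundedness is not Borel -/

/-- The set of words with characteristic function `χ`. -/
def wordSet (e : ℕ ≃ List ℕ) (χ : ℕ → Bool) : Set (List ℕ) :=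
  {s | χ (e.symm s) = true}

/-- The sections `{y | ∀ n, χ (code (χ|n, y|n))}` of a universal closed relation, as trees. -/
def sectionTree (χ : ℕ → Bool) : Set (List ℕ) :=
  {s | ∀ k ≤ s.length, χ (Encodable.encode (initSeg χ k, s.take k)) = true}

theorem isTree_sectionTree (χ : ℕ → Bool) : IsTree (sectionTree χ) := by
  rw [isTree_iff]
  intro t ht s hst k hk
  have := ht k (hk.trans hst.length_le)
  rwa [(List.prefix_iff_eq_take.1 hst), List.take_take, min_eq_left hk]

theorem isInfiniteBranch_sectionTree_iff {χ : ℕ → Bool} {y : ℕ → ℕ} :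
    IsInfiniteBranch (sectionTree χ) y ↔
      ∀ n, χ (Encodable.encode (initSeg χ n, initSeg y n)) = true := by
  constructor
  · intro h n
    have := h n n (by simp [initSeg])
    rwa [List.take_of_length_le (by simp [initSeg])] at this
  · intro h n k hk
    rw [length_initSeg] at hk
    rw [initSeg_take y hk]
    exact h k

theorem measurable_initSeg (n : ℕ) :
    Measurable[_, ⊤] (fun χ : ℕ → Bool => initSeg χ n) := by
  let _ : MeasurableSpace (List Bool) := ⊤
  induction n with
  | zero => exact measurable_const
  | succ n ih =>
    have : (fun χ : ℕ → Bool => initSeg χ (n + 1)) =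
        (fun p : List Bool × Bool => p.1 ++ [p.2]) ∘ fun χ => (initSeg χ n, χ n) := by
      funext χ
      simp [initSeg, List.range_succ]
    rw [this]
    exact (measurable_from_prod_countable_left fun b => measurable_from_top).comp
      (ih.prodMk (measurable_pi_apply n))

/-- The coordinate of χ being queried depends on χ only through `initSeg χ k`, which takes countably
many values. -/
theorem measurableSet_setOf_mem_sectionTree (s : List ℕ) :
    MeasurableSet {χ | s ∈ sectionTree χ} := by
  let _ : MeasurableSpace (List Bool) := ⊤
  have hset : {χ | s ∈ sectionTree χ} = ⋂ k, ⋂ (_ : k ≤ s.length),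
      {χ : ℕ → Bool | χ (Encodable.encode (initSeg χ k, s.take k)) = true} := by
    ext; simp [sectionTree]
  rw [hset]
  refine MeasurableSet.iInter fun k => MeasurableSet.iInter fun _ => ?_
  have h : Measurable fun p : List Bool × (ℕ → Bool) => p.2 (Encodable.encode (p.1, s.take k)) :=
    measurable_from_prod_countable_right fun l =>
      (measurable_pi_apply (Encodable.encode (l, s.take k)) : Measurable fun f : ℕ → Bool => _)
  exact (h.comp ((measurable_initSeg k).prodMk measurable_id)) (measurableSet_singleton true)

/-- The set of codes of ill-founded trees is not Borel. -/
theorem not_measurableSet_wordSet_mem_illFounded (e : ℕ ≃ List ℕ) :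
    ¬ MeasurableSet {χ | wordSet e χ ∈ illFounded} := by
  classical
  intro hmeas
  let Φ : (ℕ → Bool) → ℕ → Bool := fun χ i => decide (e i ∈ sectionTree χ)
  have hΦ : Measurable Φ := measurable_pi_lambda _ fun i =>
    measurable_to_bool (by
      have : (fun χ => Φ χ i) ⁻¹' {true} = {χ | e i ∈ sectionTree χ} := by ext; simp [Φ]
      rw [this]; exact measurableSet_setOf_mem_sectionTree _)
  have hwΦ : ∀ χ, wordSet e (Φ χ) = sectionTree χ := fun χ => by ext; simp [wordSet, Φ]
  -- The antidiagonal set; as the complement of a Borel set it is analytic.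
  let D : Set (ℕ → Bool) := {χ | sectionTree χ ∉ illFounded}
  have hD : AnalyticSet D := by
    have := polishSpace_sequences Bool
    refine MeasurableSet.analyticSet ?_
    have := (hΦ hmeas).compl
    simpa only [preimage_ofPred_eq, hwΦ, compl_ofPred] using this
  obtain ⟨C, hC⟩ : ∃ C : Set (List Bool × List ℕ), ∀ χ, χ ∈ D ↔
      ∃ y : ℕ → ℕ, ∀ n, (initSeg χ n, initSeg y n) ∈ C := by
    rw [AnalyticSet] at hD
    rcases hD with hD | ⟨g, hg, hgD⟩
    · exact ⟨∅, by simp [hD]⟩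
    -- C collects the finite prefixes of the graph of g, which is closed by continuity.
    refine ⟨{p | ∃ (y : ℕ → ℕ) (n : ℕ), p = (initSeg (g y) n, initSeg y n)}, fun χ => ?_⟩
    constructor
    · rw [← hgD]
      rintro ⟨y, rfl⟩
      exact ⟨y, fun n => ⟨y, n, rfl⟩⟩
    · rintro ⟨y, hy⟩
      choose x m hx using hy
      have hm : ∀ n, m n = n := fun n => by
        simpa using (congrArg (fun p => p.2.length) (hx n)).symm
      simp only [hm, Prod.mk.injEq, initSeg_eq_iff] at hx
      have hxy : Tendsto x atTop (𝓝 y) := tendsto_pi_nhds.2 fun i =>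
        tendsto_const_nhds.congr' <| (eventually_gt_atTop i).mono fun n hn => (hx n).2 i hn
      have hχ : Tendsto (fun n => g (x n)) atTop (𝓝 χ) := tendsto_pi_nhds.2 fun i =>
        tendsto_const_nhds.congr' <| (eventually_gt_atTop i).mono fun n hn => (hx n).1 i hn
      rw [← hgD]
      exact ⟨y, tendsto_nhds_unique ((hg.tendsto y).comp hxy) hχ⟩
  -- A code for C: membership of c in D is then equivalent to its own negation.
  let c : ℕ → Bool := fun i => decide (∃ p ∈ C, Encodable.encode p = i)
  have hc : ∀ p, c (Encodable.encode p) = true ↔ p ∈ C := fun p => by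
    simp only [c, decide_eq_true_eq, Encodable.encode_inj, exists_eq_right]
  have key : sectionTree c ∈ illFounded ↔ c ∈ D := by
    rw [hC]
    simp only [illFounded, mem_ofPred_eq, isTree_sectionTree, true_and,
      isInfiniteBranch_sectionTree_iff, hc]
  exact not_iff_self key.symm

/-! ### Transfer of non-Borelness to X -/

theorem continuous_codingShiftMap (e : ℕ ≃ List ℕ) : Continuous (codingShiftMap e) := by
  refine Continuous.subtype_mk (continuous_pi fun i => ?_) _
  simp only [shift_apply]
  exact (continuous_apply (A := fun _ => Fin 5) (i + 1)).comp continuous_subtype_val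

theorem polishSpace_codingShift (e : ℕ ≃ List ℕ) : PolishSpace (codingShift e) :=
  have := polishSpace_sequences (Fin 5)
  (isClosed_codingShift e).polishSpace

theorem continuous_treePoint_wordSet (e : ℕ ≃ List ℕ) :
    Continuous fun χ => treePoint e (wordSet e χ) := by
  refine Continuous.subtype_mk (continuous_pi fun i => ?_) _
  cases i with
  | zero => exact continuous_const
  | succ i =>
    have h : ∀ χ : ℕ → Bool, conc [3] (charSeq e (wordSet e χ)) (i + 1) =
        bif χ i then (1 : Fin 5) else 0 := fun χ => by
      rw [conc_singleton_succ]
      cases h : χ i <;> simp [charSeq, wordSet, h]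
    simp only [h]
    exact (continuous_of_discreteTopology (f := fun b : Bool => bif b then (1 : Fin 5) else 0)).comp
      (continuous_apply i)

theorem isSigmaOneOneComplete_specialAlphaLimit (e : ℕ ≃ List ℕ) :
    IsSigmaOneOneComplete (specialAlphaLimit (codingShiftMap e) (omegaZero e)) := by
  have := polishSpace_codingShift e
  refine ⟨analyticSet_specialAlphaLimit (continuous_codingShiftMap e) _, fun h => ?_⟩
  borelize ↥(codingShift e)
  refine not_measurableSet_wordSet_mem_illFounded e ?_
  have h' := (continuous_treePoint_wordSet e).measurable h
  rwa [show (fun χ => treePoint e (wordSet e χ)) ⁻¹'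
      specialAlphaLimit (codingShiftMap e) (omegaZero e) = {χ | wordSet e χ ∈ illFounded} by
    rw [← preimage_treePoint (e := e)]; rfl] at h'

end SpecialAlpha

theorem theorem3p3 (e : ℕ ≃ List ℕ) :
    SpecialAlpha.IsSubshift (SpecialAlpha.codingShift e) ∧
    SpecialAlpha.shift '' SpecialAlpha.codingShift e = SpecialAlpha.codingShift e ∧
    SpecialAlpha.IsSigmaOneOneComplete
      (SpecialAlpha.specialAlphaLimit (SpecialAlpha.codingShiftMap e)
        (SpecialAlpha.omegaZero e)) ∧
    ∃ f : Set (List ℕ) → SpecialAlpha.codingShift e,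
      (∀ T, (f T : SpecialAlpha.FullShift) =
        SpecialAlpha.conc [3] (SpecialAlpha.charSeq e T)) ∧
      Continuous[SpecialAlpha.powerTopology, instTopologicalSpaceSubtype] f ∧
      f ⁻¹' SpecialAlpha.specialAlphaLimit (SpecialAlpha.codingShiftMap e)
        (SpecialAlpha.omegaZero e) = SpecialAlpha.illFounded :=
  ⟨⟨SpecialAlpha.isClosed_codingShift e, SpecialAlpha.mapsTo_shift_codingShift e⟩,
    SpecialAlpha.image_shift_codingShift e,
    SpecialAlpha.isSigmaOneOneComplete_specialAlphaLimit e,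
    SpecialAlpha.treePoint e, fun _ => rfl, SpecialAlpha.continuous_treePoint e,
    SpecialAlpha.preimage_treePoint⟩
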